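/- Let $T$ be an Eulerian triangulation, that is, a finite connected simple plane graph (given by its rotation system, with Euler characteristic $2$) in which every face, including the outer one, has size three and every vertex has even degree. Let $V$ be its vertex set, $n=|V|$, and let $a_0,b_0,c_0$ be the three vertices of the outer face. Then the faces of $T$ can be partitioned in exactly one way into two classes $F_1,F_2$ such that no two faces sharing an edge are in the same class and the outer face is in $F_2$. Put $V'=V\setminus\{b_0,c_0\}$; then $|V'|=|F_1|=n-2$. Let $M\in\mathbb{R}^{V'\times F_1}$ be the matrix with $M(v,f)=1$ if the vertex $v$ is incident to the face $f$ and $M(v,f)=0$ otherwise. Then, for all bijections $g_{V'}:\{1,\dots,n-2\}\to V'$ and $g_{F_1}:\{1,\dots,n-2\}\to F_1$ used to index its rows and columns, $\det(M)\neq 0$. Consequently the linear system $$\sum_{f\in F_1,\ f\ni v} x_f=\begin{cases}1 & \text{if } v=a_0,\\ 0 & \text{otherwise,}\end{cases}\qquad v\in V',$$ in the unknowns $(x_f)_{f\in F_1}$ has exactly one real solution. -/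

import Mathlib

/-- A rotation system on a graph `G`: a permutation of the darts (oriented edges) whose cycles are
exactly the sets of darts leaving a common vertex, i.e. a cyclic order of the edges around every
vertex. It encodes a cellular embedding of `G` in an oriented surface. -/
structure RotationSystem {V : Type*} (G : SimpleGraph V) where
  /-- the dart that follows a given dart around its initial vertex -/
  next : Equiv.Perm G.Dart
  next_fst : ∀ d : G.Dart, (next d).fst = d.fst
  sameCycle : ∀ d e : G.Dart, d.fst = e.fst → next.SameCycle d e

namespace RotationSystem

variable {V : Type*} {G : SimpleGraph V}

/-- The face permutation: go along the dart `d`, then turn to the next edge around its end. -/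
def facePerm (T : RotationSystem G) : Equiv.Perm G.Dart :=
  (SimpleGraph.Dart.symm_involutive (G := G)).toPerm.trans T.next

/-- The faces are the cycles of the face permutation. -/
def Face (T : RotationSystem G) : Type _ :=
  Quotient (Equiv.Perm.SameCycle.setoid T.facePerm)

/-- The face whose boundary walk contains the dart `d`. -/
def faceOf (T : RotationSystem G) (d : G.Dart) : T.Face :=
  Quotient.mk (Equiv.Perm.SameCycle.setoid T.facePerm) d

/-- The size of a face is the length of its boundary walk. -/
noncomputable def faceSize (T : RotationSystem G) (f : T.Face) : ℕ :=
  {d : G.Dart | T.faceOf d = f}.ncard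

/-- The vertex `v` is incident to the face `f`. -/
def Incident (T : RotationSystem G) (v : V) (f : T.Face) : Prop :=
  ∃ d : G.Dart, d.fst = v ∧ T.faceOf d = f

/-- Two faces are adjacent if they lie on the two sides of an edge. -/
def FaceAdj (T : RotationSystem G) (f g : T.Face) : Prop :=
  ∃ d : G.Dart, T.faceOf d = f ∧ T.faceOf d.symm = g

/-- The rotation system describes an embedding of a connected graph (with at least one edge) in the
sphere: the surface obtained by gluing a disc to every face has Euler characteristic `2`. -/
def IsPlane (T : RotationSystem G) : Prop :=
  G.Connected ∧ (Nat.card V : ℤ) - (G.edgeSet.ncard : ℤ) + (Nat.card T.Face : ℤ) = 2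

/-- A triangulation is a plane graph all of whose faces have size three. -/
def IsTriangulation (T : RotationSystem G) : Prop :=
  T.IsPlane ∧ ∀ f : T.Face, T.faceSize f = 3

/-- A triangulation is Eulerian if every vertex has even degree. -/
def IsEulerianTriangulation (T : RotationSystem G) : Prop :=
  T.IsTriangulation ∧ ∀ v : V, Even (G.neighborSet v).ncard

/-- `F₁` and its complement split the set of faces so that no two adjacent faces are in the same
part, and the outer face `o` is in the complement of `F₁`. -/
def IsFirstFaceClass (T : RotationSystem G) (o : T.Face) (F₁ : Finset T.Face) : Prop :=
  o ∉ F₁ ∧ ∀ f g : T.Face, T.FaceAdj f g → (f ∈ F₁ ↔ g ∉ F₁)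

open scoped Classical in
/-- The 0/1 incidence matrix with rows `V ∖ {b₀, c₀}` and columns `F₁`. -/
noncomputable def incidenceMatrix (T : RotationSystem G) (b₀ c₀ : V) (F₁ : Finset T.Face) :
    Matrix {v : V // v ≠ b₀ ∧ v ≠ c₀} {f : T.Face // f ∈ F₁} ℝ :=
  Matrix.of fun v f => if T.Incident v.1 f.1 then 1 else 0

open scoped Classical in
/-- `x` solves the size system: for every vertex `v ≠ b₀, c₀`, the sum of `x f` over the faces
`f ∈ F₁` incident to `v` is `1` if `v = a₀` and `0` otherwise. -/
def IsSizeSolution (T : RotationSystem G) (a₀ b₀ c₀ : V) (F₁ : Finset T.Face)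
    (x : {f : T.Face // f ∈ F₁} → ℝ) : Prop :=
  ∀ v : V, v ≠ b₀ → v ≠ c₀ →
    (∑ f : {f : T.Face // f ∈ F₁} with T.Incident v f.1, x f) = if v = a₀ then 1 else 0

end RotationSystem

/-!
On a surface of Euler characteristic two every antisymmetric function on the darts whose sums
around the faces vanish is the increment of a function on the vertices, and dually with vertices
and faces exchanged. Over `ZMod 2`, with even degrees, this colors the faces with two colors; over
`ZMod 3`, with faces of size three, it colors the vertices with three colors. Each face then has
exactly one edge between any two given colors.

Let `X` be in the kernel of the incidence matrix. The total of `X` over `F₁` is the sum of its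
vertex sums over any one of the color classes. The color that `b₀` and `c₀` do not have shows that
it is zero, so the vertex sums at `b₀` and `c₀` vanish as well. Sending `X f` out of `f ∈ F₁`
across its edge between the colors `0` and `1` is therefore a flow, and has a potential `φ` on the
faces. As `φ` is constant around the vertices of color `2`, `∑ φ X = 0` over `F₁`. As the edges
between the colors `1` and `2` carry no flow, `φ²` has the same total over `F₁` as over the other
faces. Expanding `X² = 2 φ X - φ² + (φ - X)²`, where `φ - X` is the value of `φ` across the edge,
gives `∑ X² = 0`.
-/

section DartCochain

open Module

variable (K : Type*) [Field K] {V A B : Type*}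

/-- The antisymmetric functions on the darts of `G`. They serve both as the 1-cochains and as the
1-chains of a surface in which `G` is embedded. -/
def DartCochain (G : SimpleGraph V) : Submodule K (G.Dart → K) where
  carrier := {w | ∀ d, w d.symm = -w d}
  add_mem' hx hy d := (congrArg₂ (· + ·) (hx d) (hy d)).trans (neg_add _ _).symm
  zero_mem' _ := neg_zero.symm
  smul_mem' c _ hx d := (congrArg (c * ·) (hx d)).trans (mul_neg _ _)

variable {G : SimpleGraph V}

/-- The cells named by `u` (`u d` is the cell of the dart `d`, such as its initial vertex or the
face it bounds) are connected: any two are joined by a chain of darts `d`, each leading from `u d`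
to `u d.symm`. -/
def CellConnected (u : G.Dart → A) : Prop :=
  ∀ a b, Relation.ReflTransGen (fun a b => ∃ d, u d = a ∧ u d.symm = b) a b

theorem CellConnected.apply_eq {X : Type*} {u : G.Dart → A} (hu : CellConnected u) {q : A → X}
    (hq : ∀ d, q (u d) = q (u d.symm)) (a b : A) : q a = q b := by
  induction hu a b with
  | refl => rfl
  | tail _ hbc ih =>
    obtain ⟨d, rfl, rfl⟩ := hbc
    exact ih.trans (hq d)

theorem exists_dart_edge_eq (e : G.edgeSet) : ∃ d : G.Dart, d.edge = e := by
  obtain ⟨⟨x, y⟩, h⟩ := e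
  exact ⟨⟨(x, y), h⟩, rfl⟩

namespace DartCochain

theorem finrank_le [Finite G.edgeSet] : finrank K (DartCochain K G) ≤ G.edgeSet.ncard := by
  have := Fintype.ofFinite G.edgeSet
  choose s hs using exists_dart_edge_eq (G := G)
  have hinj : Function.Injective ((LinearMap.funLeft K K s).comp (DartCochain K G).subtype) := by
    refine (injective_iff_map_eq_zero _).mpr fun w hw => Subtype.ext (funext fun d => ?_)
    have hw' : ∀ e, w.1 (s e) = 0 := congrFun hw
    rcases (SimpleGraph.dart_edge_eq_iff _ _).mp (hs ⟨d.edge, d.edge_mem⟩).symm with h | h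
    · rw [h]
      exact hw' _
    · rw [h, w.2, hw', neg_zero]
      rfl
  rw [Set.ncard_eq_toFinset_card', Set.toFinset_card, ← finrank_fintype_fun_eq_card K]
  exact LinearMap.finrank_le_finrank_of_injective hinj

/-- The coboundary of a function `p` on the cells named by `u`: its increment along every dart. -/
def coboundary (u : G.Dart → A) : (A → K) →ₗ[K] DartCochain K G where
  toFun p := ⟨fun d => p (u d) - p (u d.symm), fun d => by
    simp only [SimpleGraph.Dart.symm_symm, neg_sub]⟩
  map_add' p q := Subtype.ext (funext fun d => add_sub_add_comm _ _ _ _)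
  map_smul' c p := Subtype.ext (funext fun d => (mul_sub _ _ _).symm)

/-- The boundary of a 1-chain: its total over the darts of each of the cells named by `f`. -/
def boundary [Fintype G.Dart] [DecidableEq B] (f : G.Dart → B) :
    DartCochain K G →ₗ[K] (B → K) where
  toFun w b := ∑ d with f d = b, w.1 d
  map_add' _ _ := funext fun _ => Finset.sum_add_distrib
  map_smul' _ _ := funext fun _ => (Finset.mul_sum _ _ _).symm

variable {K}

theorem finrank_ker_coboundary_le_one [Nonempty A] {u : G.Dart → A} (hu : CellConnected u) :
    finrank K (LinearMap.ker (coboundary K u)) ≤ 1 := by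
  have hone : (1 : A → K) ∈ LinearMap.ker (coboundary K u) :=
    Subtype.ext (funext fun d => sub_self _)
  refine finrank_le_one ⟨1, hone⟩ fun p => ⟨p.1 (Classical.arbitrary A), ?_⟩
  ext a
  have hp : ∀ d, p.1 (u d) = p.1 (u d.symm) := fun d =>
    sub_eq_zero.mp (congrFun (congrArg Subtype.val p.2) d)
  simpa using hu.apply_eq hp _ a

variable [Fintype G.Dart] [DecidableEq B]

theorem single_sub_single_mem_range_boundary (f : G.Dart → B) (d : G.Dart) :
    Pi.single (f d) 1 - Pi.single (f d.symm) 1 ∈ LinearMap.range (boundary K f) := by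
  classical
  have hw : (Pi.single d 1 - Pi.single d.symm 1 : G.Dart → K) ∈ DartCochain K G := fun e => by
    have h : e.symm = d ↔ e = d.symm := SimpleGraph.Dart.symm_involutive.eq_iff
    simp [Pi.single_apply, h, SimpleGraph.Dart.symm_involutive.injective.eq_iff]
  refine ⟨⟨_, hw⟩, funext fun b => ?_⟩
  calc ∑ e with f e = b, ((Pi.single d 1 : G.Dart → K) e - (Pi.single d.symm 1 : G.Dart → K) e)
      = (if f d = b then 1 else 0) - (if f d.symm = b then 1 else 0) := by
        simp only [Finset.sum_sub_distrib, Finset.sum_pi_single', Finset.mem_filter_univ]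
    _ = _ := by simp only [Pi.sub_apply, Pi.single_apply, eq_comm]

theorem finrank_coker_boundary_le_one [Finite B] [Nonempty B] {f : G.Dart → B}
    (hf : CellConnected f) : finrank K ((B → K) ⧸ LinearMap.range (boundary K f)) ≤ 1 := by
  have := Fintype.ofFinite B
  let single (b : B) : (B → K) ⧸ LinearMap.range (boundary K f) :=
    Submodule.Quotient.mk (Pi.single b 1)
  have hsingle : ∀ a b, single a = single b := hf.apply_eq fun d =>
    (Submodule.Quotient.eq _).mpr (single_sub_single_mem_range_boundary f d)
  let b₀ := Classical.arbitrary B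
  refine finrank_le_one (single b₀) fun y => ?_
  obtain ⟨x, rfl⟩ := Submodule.mkQ_surjective _ y
  refine ⟨∑ b, x b, ?_⟩
  calc (∑ b, x b) • single b₀ = ∑ b, x b • single b := by
        rw [Finset.sum_smul]
        exact Finset.sum_congr rfl fun b _ => by rw [hsingle b₀ b]
    _ = Submodule.mkQ _ (∑ b, x b • Pi.single b 1) := by
        simp only [map_sum, map_smul]
        rfl
    _ = Submodule.mkQ _ x := by
        congr 1
        ext b
        simp [Pi.single_apply]

theorem boundary_coboundary {u : G.Dart → A} {f : G.Dart → B} (σ : Equiv.Perm G.Dart)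
    (hf : ∀ d, f (σ d) = f d) (hu : ∀ d, u (σ d) = u d.symm) (p : A → K) :
    boundary K f (coboundary K u p) = 0 := by
  funext b
  have hσ : ∑ d with f d = b, p (u d.symm) = ∑ d with f d = b, p (u d) :=
    Finset.sum_equiv σ (by simp [hf]) (by simp [hu])
  exact (Finset.sum_sub_distrib _ _).trans (sub_eq_zero.mpr hσ.symm)

-- The 1-cycles have dimension at most `E - (B - 1)` and the coboundaries at least `A - 1`: these
-- numbers agree exactly when the Euler characteristic is two.
theorem range_coboundary_eq_ker_boundary [Finite A] [Finite B] [Nonempty A] [Nonempty B]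
    {u : G.Dart → A} {f : G.Dart → B} (hu : CellConnected u) (hf : CellConnected f)
    (hcomp : ∀ p : A → K, boundary K f (coboundary K u p) = 0)
    (hEuler : Nat.card A + Nat.card B = G.edgeSet.ncard + 2) :
    LinearMap.range (coboundary K u) = LinearMap.ker (boundary K f) := by
  have := Fintype.ofFinite A
  have := Fintype.ofFinite B
  have : Finite G.edgeSet :=
    .of_surjective (fun d : G.Dart => (⟨d.edge, d.edge_mem⟩ : G.edgeSet)) fun e =>
      (exists_dart_edge_eq e).imp fun _ h => Subtype.ext h
  have hle : LinearMap.range (coboundary K u) ≤ LinearMap.ker (boundary K f) := by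
    rintro _ ⟨p, rfl⟩
    exact hcomp p
  have hA := LinearMap.finrank_range_add_finrank_ker (coboundary K u)
  have hE := LinearMap.finrank_range_add_finrank_ker (boundary K f)
  have hB := Submodule.finrank_quotient_add_finrank (LinearMap.range (boundary K f))
  have hker := finrank_ker_coboundary_le_one (K := K) hu
  have hcoker := finrank_coker_boundary_le_one (K := K) hf
  have hW := finrank_le K (G := G)
  simp only [finrank_fintype_fun_eq_card, ← Nat.card_eq_fintype_card] at hA hB
  exact Submodule.eq_of_le_of_finrank_le hle (by lia)

theorem exists_potential [Finite A] [Finite B] {u : G.Dart → A} {f : G.Dart → B}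
    (hu : CellConnected u) (hf : CellConnected f) (σ : Equiv.Perm G.Dart)
    (hfσ : ∀ d, f (σ d) = f d) (huσ : ∀ d, u (σ d) = u d.symm)
    (hEuler : Nat.card A + Nat.card B = G.edgeSet.ncard + 2) {w : G.Dart → K}
    (hw : ∀ d, w d.symm = -w d) (hw0 : ∀ b, ∑ d with f d = b, w d = 0) :
    ∃ p : A → K, ∀ d, p (u d) - p (u d.symm) = w d := by
  rcases isEmpty_or_nonempty G.Dart with _ | _
  · exact ⟨0, isEmptyElim⟩
  have : Nonempty A := .map u inferInstance
  have : Nonempty B := .map f inferInstance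
  have hmem : (⟨w, hw⟩ : DartCochain K G) ∈ LinearMap.ker (boundary K f) := funext hw0
  rw [← range_coboundary_eq_ker_boundary hu hf (boundary_coboundary σ hfσ huσ) hEuler] at hmem
  obtain ⟨p, hp⟩ := hmem
  exact ⟨p, congrFun (congrArg Subtype.val hp)⟩

end DartCochain

end DartCochain

namespace RotationSystem

section Plane

variable {V : Type*} {G : SimpleGraph V} {T : RotationSystem G}

theorem faceOf_surjective : Function.Surjective T.faceOf := Quotient.mk_surjective

instance [Finite G.Dart] : Finite T.Face := .of_surjective _ T.faceOf_surjective

theorem fst_facePerm (d : G.Dart) : (T.facePerm d).fst = d.snd :=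
  T.next_fst d.symm

theorem faceOf_facePerm (d : G.Dart) : T.faceOf (T.facePerm d) = T.faceOf d :=
  Quotient.sound (Equiv.Perm.sameCycle_apply_left.mpr (.refl _ _))

theorem faceOf_next (d : G.Dart) : T.faceOf (T.next d) = T.faceOf d.symm :=
  T.faceOf_facePerm d.symm

theorem next_induction [Finite G.Dart] {P : G.Dart → Prop} {d e : G.Dart} (he : e.fst = d.fst)
    (hd : P d) (hnext : ∀ x, x.fst = d.fst → P x → P (T.next x)) : P e := by
  obtain ⟨n, rfl⟩ := (T.sameCycle d e he.symm).exists_nat_pow_eq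
  have hpow : ∀ n : ℕ, ((T.next ^ n) d).fst = d.fst ∧ P ((T.next ^ n) d) := fun n => by
    induction n with
    | zero => exact ⟨rfl, hd⟩
    | succ n ih =>
      rw [pow_succ', Equiv.Perm.mul_apply]
      exact ⟨(T.next_fst _).trans ih.1, hnext _ ih.1 ih.2⟩
  exact (hpow n).2

theorem cellConnected_fst (hG : G.Connected) : CellConnected fun d : G.Dart => d.fst := fun v w =>
  ((G.reachable_iff_reflTransGen v w).mp (hG.preconnected v w)).lift id fun _ _ h =>
    ⟨⟨(_, _), h⟩, rfl, rfl⟩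

theorem cellConnected_faceOf [Finite G.Dart] (hG : G.Connected) : CellConnected T.faceOf := by
  have hturn : ∀ {d e : G.Dart}, e.fst = d.fst →
      Relation.ReflTransGen T.FaceAdj (T.faceOf d) (T.faceOf e) := fun {d e} he =>
    T.next_induction (P := fun x => Relation.ReflTransGen T.FaceAdj (T.faceOf d) (T.faceOf x)) he
      .refl fun x _ ih => ih.tail ⟨x, rfl, (T.faceOf_next x).symm⟩
  have hwalk : ∀ {v w : V}, G.Walk v w → ∀ d e : G.Dart, d.fst = v → e.fst = w →
      Relation.ReflTransGen T.FaceAdj (T.faceOf d) (T.faceOf e) := fun p => by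
    induction p with
    | nil => exact fun d e hd he => hturn (he.trans hd.symm)
    | cons huv _ ih =>
      intro d e hd he
      let x : G.Dart := ⟨(_, _), huv⟩
      exact ((hturn hd.symm).tail ⟨x, rfl, rfl⟩).trans (ih x.symm e rfl he)
  intro f g
  obtain ⟨d, rfl⟩ := T.faceOf_surjective f
  obtain ⟨e, rfl⟩ := T.faceOf_surjective g
  exact hwalk (hG.preconnected d.fst e.fst).some d e rfl rfl

theorem exists_vertexPotential [Finite V] [Fintype G.Dart] [DecidableEq T.Face] (hT : T.IsPlane)
    {K : Type*} [Field K] {w : G.Dart → K} (hw : ∀ d, w d.symm = -w d)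
    (hw0 : ∀ f, ∑ d with T.faceOf d = f, w d = 0) :
    ∃ p : V → K, ∀ d : G.Dart, p d.fst - p d.snd = w d :=
  DartCochain.exists_potential (cellConnected_fst hT.1) (cellConnected_faceOf hT.1) T.facePerm
    T.faceOf_facePerm T.fst_facePerm (by have := hT.2; lia) hw hw0

theorem exists_facePotential [Finite V] [Fintype G.Dart] [DecidableEq V] (hT : T.IsPlane)
    {K : Type*} [Field K] {w : G.Dart → K} (hw : ∀ d, w d.symm = -w d)
    (hw0 : ∀ v, ∑ d : G.Dart with d.fst = v, w d = 0) :
    ∃ p : T.Face → K, ∀ d : G.Dart, p (T.faceOf d) - p (T.faceOf d.symm) = w d :=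
  DartCochain.exists_potential (cellConnected_faceOf hT.1) (cellConnected_fst hT.1) T.next
    T.next_fst T.faceOf_next (by have := hT.2; lia) hw hw0

end Plane

section FaceColorClass

variable {V : Type*} {G : SimpleGraph V} {T : RotationSystem G}

/-- `F` is one of the two classes of a proper coloring of the faces with two colors: every edge
has exactly one side in `F`. Unlike in `IsFirstFaceClass`, no outer face is singled out. -/
def IsFaceColorClass (T : RotationSystem G) (F : Finset T.Face) : Prop :=
  ∀ d : G.Dart, T.faceOf d ∈ F ↔ T.faceOf d.symm ∉ F

theorem IsFirstFaceClass.isFaceColorClass {o : T.Face} {F : Finset T.Face}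
    (hF : T.IsFirstFaceClass o F) : T.IsFaceColorClass F :=
  fun d => hF.2 _ _ ⟨d, rfl, rfl⟩

theorem IsFaceColorClass.eq_of_mem_iff_mem [Finite G.Dart] (hG : G.Connected) {F F' : Finset T.Face}
    (hF : T.IsFaceColorClass F) (hF' : T.IsFaceColorClass F') {o : T.Face}
    (ho : o ∈ F ↔ o ∈ F') : F = F' := by
  have hside : ∀ d : G.Dart, (T.faceOf d ∈ F ↔ T.faceOf d ∈ F') =
      (T.faceOf d.symm ∈ F ↔ T.faceOf d.symm ∈ F') := fun d => by
    rw [hF d, hF' d, not_iff_not]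
  ext f
  exact ((cellConnected_faceOf hG).apply_eq (q := fun f => (f ∈ F ↔ f ∈ F')) hside f o).mpr ho

theorem exists_isFirstFaceClass [Finite V] (hT : T.IsPlane)
    (heven : ∀ v, Even (G.neighborSet v).ncard) (o : T.Face) :
    ∃ F : Finset T.Face, T.IsFirstFaceClass o F := by
  classical
  have := Fintype.ofFinite V
  have := Fintype.ofFinite T.Face
  have hdeg : ∀ v, ∑ d : G.Dart with d.fst = v, (1 : ZMod 2) = 0 := fun v => by
    rw [Finset.sum_const, nsmul_one, ZMod.natCast_eq_zero_iff_even,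
      G.dart_fst_fiber_card_eq_degree, ← G.card_neighborSet_eq_degree, ← Nat.card_eq_fintype_card]
    exact heven v
  obtain ⟨p, hp⟩ := exists_facePotential hT (fun _ => rfl) hdeg
  have hflip : ∀ a b c : ZMod 2, a - b = 1 → (a ≠ c ↔ ¬b ≠ c) := by decide
  refine ⟨({f | p f ≠ p o} : Finset T.Face), by simp, ?_⟩
  rintro _ _ ⟨d, rfl, rfl⟩
  simpa only [Finset.mem_filter_univ] using hflip _ _ _ (hp d)

theorem existsUnique_isFirstFaceClass [Finite V] (hT : T.IsPlane)
    (heven : ∀ v, Even (G.neighborSet v).ncard) (o : T.Face) :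
    ∃! F : Finset T.Face, T.IsFirstFaceClass o F := by
  have : Finite G.Dart := .of_injective _ SimpleGraph.Dart.toProd_injective
  refine existsUnique_of_exists_of_unique (exists_isFirstFaceClass hT heven o) fun F F' hF hF' => ?_
  exact hF.isFaceColorClass.eq_of_mem_iff_mem hT.1 hF'.isFaceColorClass (iff_of_false hF.1 hF'.1)

end FaceColorClass

section CyclicColoring

variable {V : Type*} {G : SimpleGraph V} {T : RotationSystem G}

/-- Given a face color class `F`, a cyclic coloring is a proper coloring of the vertices with the
colors `ZMod 3` that increase by one along the boundary walks of the faces in `F`, and so decrease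
by one along those of the other faces. -/
def IsCyclicColoring (T : RotationSystem G) (F : Finset T.Face) (col : V → ZMod 3) : Prop :=
  ∀ d : G.Dart, T.faceOf d ∈ F → col d.snd = col d.fst + 1

theorem card_filter_faceOf [Fintype G.Dart] [DecidableEq T.Face] (h3 : ∀ f, T.faceSize f = 3)
    (f : T.Face) : Finset.card {d | T.faceOf d = f} = 3 := by
  rw [← h3 f, faceSize, ← Set.ncard_coe_finset, Finset.coe_filter_univ]

theorem card_dart [Fintype G.Dart] [Fintype T.Face] (h3 : ∀ f, T.faceSize f = 3) :
    Fintype.card G.Dart = 3 * Fintype.card T.Face := by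
  classical
  rw [← Finset.card_univ,
    Finset.card_eq_sum_card_fiberwise (f := T.faceOf) fun _ _ => Finset.mem_univ _,
    Finset.sum_congr rfl fun f _ => card_filter_faceOf h3 f, Finset.sum_const, smul_eq_mul,
    Finset.card_univ, mul_comm]

theorem IsFaceColorClass.exists_isCyclicColoring [Finite V] {F : Finset T.Face}
    (hF : T.IsFaceColorClass F) (hT : T.IsTriangulation) : ∃ col, T.IsCyclicColoring F col := by
  classical
  have := Fintype.ofFinite V
  let w (d : G.Dart) : ZMod 3 := if T.faceOf d ∈ F then -1 else 1
  have hsymm : ∀ d, w d.symm = -w d := fun d => by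
    by_cases h : T.faceOf d.symm ∈ F <;> simp [w, hF d, h]
  have hthree : ∀ a : ZMod 3, 3 • a = 0 := by decide
  have hface : ∀ f, ∑ d with T.faceOf d = f, w d = 0 := fun f => by
    have hw : ∀ d ∈ ({d | T.faceOf d = f} : Finset G.Dart), w d = if f ∈ F then -1 else 1 :=
      fun d hd => by rw [← (Finset.mem_filter_univ d).mp hd]
    rw [Finset.sum_congr rfl hw, Finset.sum_const, card_filter_faceOf hT.2, hthree]
  obtain ⟨col, hcol⟩ := exists_vertexPotential hT.1 hsymm hface
  refine ⟨col, fun d hd => ?_⟩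
  rw [← sub_eq_iff_eq_add', ← neg_sub, hcol]
  simp [w, hd]

namespace IsCyclicColoring

variable {F : Finset T.Face} {col : V → ZMod 3} (hcol : T.IsCyclicColoring F col)

section Dart

variable (hF : T.IsFaceColorClass F)

include hcol hF

theorem fst_eq_snd_add_one {d : G.Dart} (hd : T.faceOf d ∉ F) : col d.fst = col d.snd + 1 :=
  hcol d.symm (not_not.mp (mt (hF d).mpr hd))

theorem exists_dart (f : T.Face) (k : ZMod 3) : ∃ d, T.faceOf d = f ∧ col d.fst = k := by
  obtain ⟨e, he, hstep⟩ :
      ∃ e : ZMod 3, e ≠ 0 ∧ ∀ d, T.faceOf d = f → col d.snd = col d.fst + e := by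
    by_cases hf : f ∈ F
    · exact ⟨1, by decide, fun d hd => hcol d (hd ▸ hf)⟩
    · exact ⟨-1, by decide, fun d hd =>
        eq_add_neg_of_add_eq (hcol.fst_eq_snd_add_one hF (hd ▸ hf)).symm⟩
  obtain ⟨d, hd⟩ := T.faceOf_surjective f
  have hd₁ := (T.faceOf_facePerm d).trans hd
  have hd₂ := (T.faceOf_facePerm _).trans hd₁
  have hcol₁ : col (T.facePerm d).fst = col d.fst + e := by rw [fst_facePerm, hstep d hd]
  have hcol₂ : col (T.facePerm (T.facePerm d)).fst = col d.fst + e + e := by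
    rw [fst_facePerm, hstep _ hd₁, hcol₁]
  have hthree : ∀ a e k : ZMod 3, e ≠ 0 → a = k ∨ a + e = k ∨ a + e + e = k := by decide
  rcases hthree (col d.fst) e k he with h | h | h
  · exact ⟨_, hd, h⟩
  · exact ⟨_, hd₁, hcol₁.trans h⟩
  · exact ⟨_, hd₂, hcol₂.trans h⟩

variable [Finite G.Dart] (h3 : ∀ f, T.faceSize f = 3)

include h3

theorem dart_ext {d e : G.Dart} (hface : T.faceOf d = T.faceOf e) (hfst : col d.fst = col e.fst) :
    d = e := by
  classical
  have := Fintype.ofFinite G.Dart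
  have hsurj : Set.SurjOn (fun x : G.Dart => col x.fst)
      ({x | T.faceOf x = T.faceOf e} : Finset G.Dart) (Finset.univ : Finset (ZMod 3)) := fun k _ =>
    (hcol.exists_dart hF (T.faceOf e) k).imp fun x hx => ⟨by simpa using hx.1, hx.2⟩
  exact Finset.injOn_of_surjOn_of_card_le _ (fun _ _ => Finset.mem_coe.mpr (Finset.mem_univ _))
    hsurj (card_filter_faceOf h3 _).le (by simpa using hface) (by simp) hfst

theorem ne_of_incident {v w : V} {f : T.Face} (hv : T.Incident v f) (hw : T.Incident w f)
    (hvw : v ≠ w) : col v ≠ col w := by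
  obtain ⟨d, rfl, hd⟩ := hv
  obtain ⟨e, rfl, he⟩ := hw
  exact fun h => hvw (congrArg (·.fst) (hcol.dart_ext hF h3 (hd.trans he.symm) h))

end Dart

end IsCyclicColoring

/-- The darts with initial vertex of color `k` and face in `F`. For a cyclic coloring of a
triangulation they represent the edges between the colors `k` and `k + 1`, and each face has exactly
one of these edges on its boundary. -/
def coloredDarts (T : RotationSystem G) [Fintype G.Dart] [DecidableEq T.Face] (F : Finset T.Face)
    (col : V → ZMod 3) (k : ZMod 3) : Finset G.Dart :=
  {d | T.faceOf d ∈ F ∧ col d.fst = k}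

/-- The sum of the values of `X` at the faces in `F` around the vertex `v`, where a face counts once
for each of its corners at `v`. -/
def vertexSum (T : RotationSystem G) [Fintype G.Dart] [DecidableEq V] [DecidableEq T.Face]
    {K : Type*} [AddCommMonoid K] (F : Finset T.Face) (X : T.Face → K) (v : V) : K :=
  ∑ d : G.Dart with d.fst = v ∧ T.faceOf d ∈ F, X (T.faceOf d)

theorem mem_coloredDarts [Fintype G.Dart] [DecidableEq T.Face] {F : Finset T.Face}
    {col : V → ZMod 3} {k : ZMod 3} {d : G.Dart} :
    d ∈ T.coloredDarts F col k ↔ T.faceOf d ∈ F ∧ col d.fst = k :=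
  Finset.mem_filter_univ _

theorem sum_coloredDarts_eq_sum_vertex [Fintype V] [Fintype G.Dart] [DecidableEq V]
    [DecidableEq T.Face] {M : Type*} [AddCommMonoid M] (F : Finset T.Face) (col : V → ZMod 3)
    (k : ZMod 3) (g : G.Dart → M) :
    ∑ d ∈ T.coloredDarts F col k, g d =
      ∑ v with col v = k, ∑ d : G.Dart with d.fst = v ∧ T.faceOf d ∈ F, g d := by
  rw [← Finset.sum_fiberwise_of_maps_to (g := fun d : G.Dart => d.fst) (t := {v | col v = k})
    fun d hd => Finset.mem_filter_univ _ |>.mpr (mem_coloredDarts.mp hd).2]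
  refine Finset.sum_congr rfl fun v hv => Finset.sum_congr ?_ fun _ _ => rfl
  ext d
  rw [Finset.mem_filter_univ] at hv
  simp only [Finset.mem_filter, mem_coloredDarts, Finset.mem_univ, true_and]
  exact ⟨fun h => ⟨h.2, h.1.1⟩, fun h => ⟨⟨h.2, h.1 ▸ hv⟩, h.1⟩⟩

section Sums

variable {F : Finset T.Face} {col : V → ZMod 3} (hcol : T.IsCyclicColoring F col)
  (hF : T.IsFaceColorClass F) (h3 : ∀ f, T.faceSize f = 3) [Fintype G.Dart] [DecidableEq T.Face]
  {M : Type*} [AddCommMonoid M]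

include hcol hF h3

theorem IsCyclicColoring.sum_coloredDarts (k : ZMod 3) (g : T.Face → M) :
    ∑ d ∈ T.coloredDarts F col k, g (T.faceOf d) = ∑ f ∈ F, g f := by
  refine Finset.sum_nbij T.faceOf (fun d hd => (mem_coloredDarts.mp hd).1) ?_ ?_ fun _ _ => rfl
  · intro d hd e he hde
    exact hcol.dart_ext hF h3 hde ((mem_coloredDarts.mp hd).2.trans (mem_coloredDarts.mp he).2.symm)
  · intro f hf
    obtain ⟨d, rfl, hk⟩ := hcol.exists_dart hF f k
    exact ⟨d, mem_coloredDarts.mpr ⟨hf, hk⟩, rfl⟩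

theorem IsCyclicColoring.sum_coloredDarts_symm [Fintype T.Face] (k : ZMod 3) (g : T.Face → M) :
    ∑ d ∈ T.coloredDarts F col k, g (T.faceOf d.symm) = ∑ f ∈ Fᶜ, g f := by
  have hsnd : ∀ d ∈ T.coloredDarts F col k, col d.snd = k + 1 := fun d hd => by
    rw [hcol d (mem_coloredDarts.mp hd).1, (mem_coloredDarts.mp hd).2]
  refine Finset.sum_nbij (fun d => T.faceOf d.symm) (fun d hd => ?_) ?_ ?_ fun _ _ => rfl
  · exact Finset.mem_compl.mpr ((hF d).mp (mem_coloredDarts.mp hd).1)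
  · intro d hd e he hde
    exact SimpleGraph.Dart.symm_involutive.injective
      (hcol.dart_ext hF h3 hde ((hsnd d hd).trans (hsnd e he).symm))
  · intro f hf
    obtain ⟨d, rfl, hk⟩ := hcol.exists_dart hF f (k + 1)
    have hd := Finset.mem_compl.mp hf
    refine ⟨d.symm, mem_coloredDarts.mpr ⟨not_not.mp (mt (hF d).mpr hd), ?_⟩, by simp⟩
    exact add_right_cancel ((hcol.fst_eq_snd_add_one hF hd).symm.trans hk)

theorem IsCyclicColoring.sum_eq_sum_compl [Fintype T.Face] {k : ZMod 3} {g : T.Face → M}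
    (hg : ∀ d ∈ T.coloredDarts F col k, g (T.faceOf d) = g (T.faceOf d.symm)) :
    ∑ f ∈ F, g f = ∑ f ∈ Fᶜ, g f := by
  rw [← hcol.sum_coloredDarts hF h3 k, ← hcol.sum_coloredDarts_symm hF h3 k]
  exact Finset.sum_congr rfl hg

theorem IsCyclicColoring.sum_vertexSum [Fintype V] [DecidableEq V] (k : ZMod 3) (X : T.Face → M) :
    ∑ v with col v = k, T.vertexSum F X v = ∑ f ∈ F, X f :=
  (sum_coloredDarts_eq_sum_vertex F col k _).symm.trans (hcol.sum_coloredDarts hF h3 k X)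

theorem IsCyclicColoring.vertexSum_eq_sum_incident [DecidableEq V] (X : T.Face → M) (v : V)
    [DecidablePred (T.Incident v)] : T.vertexSum F X v = ∑ f ∈ F with T.Incident v f, X f := by
  refine Finset.sum_nbij T.faceOf (fun d hd => ?_) ?_ ?_ fun _ _ => rfl
  · obtain ⟨hv, hf⟩ := (Finset.mem_filter_univ _).mp hd
    exact Finset.mem_filter.mpr ⟨hf, d, hv, rfl⟩
  · intro d hd e he hde
    obtain ⟨rfl, -⟩ := (Finset.mem_filter_univ _).mp hd
    exact hcol.dart_ext hF h3 hde (congrArg col ((Finset.mem_filter_univ _).mp he).1.symm)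
  · intro f hf
    obtain ⟨hfF, d, hv, rfl⟩ := Finset.mem_filter.mp hf
    exact ⟨d, (Finset.mem_filter_univ _).mpr ⟨hv, hfF⟩, rfl⟩

end Sums

theorem IsFaceColorClass.card_add_two [Fintype V] {F : Finset T.Face} (hF : T.IsFaceColorClass F)
    (hT : T.IsTriangulation) : F.card + 2 = Fintype.card V := by
  classical
  have := Fintype.ofFinite T.Face
  obtain ⟨col, hcol⟩ := hF.exists_isCyclicColoring hT
  have hcompl : F.card = Fᶜ.card := by
    simpa using hcol.sum_eq_sum_compl hF hT.2 (k := 0) (g := fun _ => (1 : ℕ)) fun _ _ => rfl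
  have hface := F.card_add_card_compl
  have hedge : Fintype.card G.Dart = 2 * G.edgeSet.ncard := by
    rw [G.dart_card_eq_twice_card_edges, ← SimpleGraph.coe_edgeFinset, Set.ncard_coe_finset]
  have hdart := card_dart hT.2
  have hEuler := hT.1.2
  simp only [Nat.card_eq_fintype_card] at hEuler
  lia

end CyclicColoring

/-- A potential, on the faces, of the flow that crosses the edges between the colors `0` and `1` and
carries the value `X f` out of the face `f ∈ F` (and into the face on the other side of that
edge). -/
def IsFlowPotential {V : Type*} {G : SimpleGraph V} (T : RotationSystem G) {K : Type*} [Field K]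
    (F : Finset T.Face) (col : V → ZMod 3) (X φ : T.Face → K) : Prop :=
  ∀ d : G.Dart, T.faceOf d ∈ F →
    (col d.fst = 0 → φ (T.faceOf d) - φ (T.faceOf d.symm) = X (T.faceOf d)) ∧
    (col d.fst ≠ 0 → φ (T.faceOf d) = φ (T.faceOf d.symm))

section Kernel

variable {V : Type*} {G : SimpleGraph V} {T : RotationSystem G} {F : Finset T.Face}
  {col : V → ZMod 3} (hcol : T.IsCyclicColoring F col) (hF : T.IsFaceColorClass F)

include hcol hF

theorem IsCyclicColoring.vertexSum_eq_zero [Finite V] [Fintype G.Dart] [DecidableEq V]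
    [DecidableEq T.Face] {M : Type*} [AddCommMonoid M] (h3 : ∀ f, T.faceSize f = 3) {b c : V}
    (hbc : col b ≠ col c) {X : T.Face → M}
    (hX : ∀ v, v ≠ b → v ≠ c → T.vertexSum F X v = 0) (v : V) : T.vertexSum F X v = 0 := by
  have := Fintype.ofFinite V
  have hthird : ∀ i j : ZMod 3, ∃ k, k ≠ i ∧ k ≠ j := by decide
  obtain ⟨k, hkb, hkc⟩ := hthird (col b) (col c)
  have htotal : ∑ f ∈ F, X f = 0 := by
    rw [← hcol.sum_vertexSum hF h3 k]
    refine Finset.sum_eq_zero fun w hw => ?_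
    obtain rfl := (Finset.mem_filter_univ w).mp hw
    exact hX w (ne_of_apply_ne col hkb) (ne_of_apply_ne col hkc)
  by_cases hv : v ≠ b ∧ v ≠ c
  · exact hX v hv.1 hv.2
  rw [← htotal, ← hcol.sum_vertexSum hF h3 (col v)]
  refine (Finset.sum_eq_single_of_mem v (by simp) fun w hw hwv => ?_).symm
  have hwcol := (Finset.mem_filter_univ w).mp hw
  grind

variable {K : Type*} [Field K]

-- Turning around a vertex alternates between the faces in `F` and the other faces, so the flow out
-- of the faces around a vertex of color `0` and the flow into those around a vertex of color `1`
-- both add up to the vertex sum.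
theorem IsCyclicColoring.exists_isFlowPotential [Finite V] [Fintype G.Dart] [DecidableEq V]
    [DecidableEq T.Face] (hT : T.IsPlane) {X : T.Face → K} (hX : ∀ v, T.vertexSum F X v = 0) :
    ∃ φ : T.Face → K, T.IsFlowPotential F col X φ := by
  let flow (k : ZMod 3) (d : G.Dart) : K :=
    if T.faceOf d ∈ F ∧ col d.fst = k then X (T.faceOf d) else 0
  have hsum : ∀ k v, ∑ d : G.Dart with d.fst = v, flow k d = 0 := fun k v => by
    by_cases hv : col v = k
    · rw [← hX v, vertexSum, ← Finset.filter_filter, Finset.sum_filter (T.faceOf · ∈ F)]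
      refine Finset.sum_congr rfl fun d hd => ?_
      simp only [flow, (Finset.mem_filter_univ d).mp hd, hv, and_true]
    · refine Finset.sum_eq_zero fun d hd => ?_
      simp only [flow, (Finset.mem_filter_univ d).mp hd, hv, and_false, if_false]
  have hsymm : ∀ d : G.Dart, flow 0 d.symm = flow 1 (T.next d) := fun d => by
    by_cases hd : T.faceOf d.symm ∈ F
    · have : col d.fst = col d.snd + 1 := hcol d.symm hd
      simp only [flow, faceOf_next, next_fst, this, add_eq_right, hd, true_and]
      rfl
    · simp only [flow, faceOf_next, hd, false_and, if_false]
  have hsum_next : ∀ v, ∑ d : G.Dart with d.fst = v, flow 1 (T.next d) = 0 := fun v =>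
    (Finset.sum_equiv T.next (by simp [next_fst]) fun _ _ => rfl).trans (hsum 1 v)
  obtain ⟨φ, hφ⟩ := exists_facePotential hT (w := fun d => flow 0 d - flow 0 d.symm)
    (fun d => by rw [SimpleGraph.Dart.symm_symm, neg_sub])
    fun v => by simp only [Finset.sum_sub_distrib, hsymm, hsum, hsum_next, sub_zero]
  refine ⟨φ, fun d hd => ⟨fun h => ?_, fun h => sub_eq_zero.mp ?_⟩⟩ <;>
    simp [hφ, flow, hd, h, (hF d).mp hd]

namespace IsFlowPotential

variable {X φ : T.Face → K} (hφ : T.IsFlowPotential F col X φ)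

include hφ

theorem eq_of_fst_eq [Finite G.Dart] {d e : G.Dart} (hd : col d.fst = 2) (he : e.fst = d.fst) :
    φ (T.faceOf e) = φ (T.faceOf d) := by
  refine T.next_induction (P := fun x => φ (T.faceOf x) = φ (T.faceOf d)) he rfl fun x hx ih => ?_
  rw [faceOf_next, ← ih]
  have hx2 : col x.fst = 1 + 1 := (congrArg col hx).trans hd
  by_cases hxF : T.faceOf x ∈ F
  · exact ((hφ x hxF).2 (hx2 ▸ by decide)).symm
  · have hsnd : col x.symm.fst = 1 :=
      add_right_cancel ((hcol.fst_eq_snd_add_one hF hxF).symm.trans hx2)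
    exact (hφ x.symm (not_not.mp (mt (hF x).mpr hxF))).2 (hsnd ▸ by decide)

variable (h3 : ∀ f, T.faceSize f = 3) [Finite V] [Fintype G.Dart] [DecidableEq V]
  [DecidableEq T.Face] (hX : ∀ v, T.vertexSum F X v = 0)

include h3 hX

theorem sum_mul_eq_zero : ∑ f ∈ F, φ f * X f = 0 := by
  have := Fintype.ofFinite V
  rw [← hcol.sum_coloredDarts hF h3 2 fun f => φ f * X f, sum_coloredDarts_eq_sum_vertex]
  refine Finset.sum_eq_zero fun v hv => ?_
  rw [Finset.mem_filter_univ] at hv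
  rcases ({d | d.fst = v ∧ T.faceOf d ∈ F} : Finset G.Dart).eq_empty_or_nonempty with h | ⟨e, he⟩
  · rw [h, Finset.sum_empty]
  obtain ⟨rfl, -⟩ := (Finset.mem_filter_univ e).mp he
  calc ∑ d : G.Dart with d.fst = e.fst ∧ T.faceOf d ∈ F, φ (T.faceOf d) * X (T.faceOf d)
      = ∑ d : G.Dart with d.fst = e.fst ∧ T.faceOf d ∈ F, φ (T.faceOf e) * X (T.faceOf d) :=
        Finset.sum_congr rfl fun d hd => by
          rw [hφ.eq_of_fst_eq hcol hF hv ((Finset.mem_filter_univ d).mp hd).1]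
    _ = φ (T.faceOf e) * T.vertexSum F X e.fst := (Finset.mul_sum _ _ _).symm
    _ = 0 := by rw [hX, mul_zero]

theorem sum_sq_eq_zero : ∑ f ∈ F, X f ^ 2 = 0 := by
  have := Fintype.ofFinite T.Face
  have hsq : ∑ f ∈ F, φ f ^ 2 = ∑ f ∈ Fᶜ, φ f ^ 2 :=
    hcol.sum_eq_sum_compl hF h3 (k := 1) (g := fun f => φ f ^ 2) fun d hd => by
      obtain ⟨hdF, hd1⟩ := mem_coloredDarts.mp hd
      rw [(hφ d hdF).2 (hd1 ▸ by decide)]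
  calc ∑ f ∈ F, X f ^ 2
      = ∑ d ∈ T.coloredDarts F col 0, X (T.faceOf d) ^ 2 :=
        (hcol.sum_coloredDarts hF h3 0 fun f => X f ^ 2).symm
    _ = ∑ d ∈ T.coloredDarts F col 0, (2 * (φ (T.faceOf d) * X (T.faceOf d)) -
          φ (T.faceOf d) ^ 2 + φ (T.faceOf d.symm) ^ 2) :=
        Finset.sum_congr rfl fun d hd => by
          obtain ⟨hdF, hd0⟩ := mem_coloredDarts.mp hd
          rw [← (hφ d hdF).1 hd0]
          ring
    _ = 2 * ∑ f ∈ F, φ f * X f - ∑ f ∈ F, φ f ^ 2 + ∑ f ∈ Fᶜ, φ f ^ 2 := by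
        rw [Finset.sum_add_distrib, Finset.sum_sub_distrib, ← Finset.mul_sum,
          hcol.sum_coloredDarts hF h3 0 fun f => φ f * X f,
          hcol.sum_coloredDarts hF h3 0 fun f => φ f ^ 2,
          hcol.sum_coloredDarts_symm hF h3 0 fun f => φ f ^ 2]
    _ = 0 := by
        rw [hφ.sum_mul_eq_zero hcol hF h3 hX, hsq]
        ring

end IsFlowPotential

variable [LinearOrder K] [IsStrictOrderedRing K]

theorem IsCyclicColoring.eq_zero_of_vertexSum_eq_zero [Finite V] [Fintype G.Dart] [DecidableEq V]
    [DecidableEq T.Face] (hT : T.IsTriangulation) {X : T.Face → K}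
    (hX : ∀ v, T.vertexSum F X v = 0) {f : T.Face} (hf : f ∈ F) : X f = 0 := by
  obtain ⟨φ, hφ⟩ := hcol.exists_isFlowPotential hF hT.1 hX
  have hsq := hφ.sum_sq_eq_zero hcol hF hT.2 hX
  exact pow_eq_zero_iff two_ne_zero |>.mp <|
    (Finset.sum_eq_zero_iff_of_nonneg fun f _ => sq_nonneg (X f)).mp hsq f hf

end Kernel

section IncidenceMatrix

variable {V : Type*} {G : SimpleGraph V} {T : RotationSystem G} {F : Finset T.Face}

open scoped Classical in
theorem incidenceMatrix_mulVec (b c : V) (x : {f : T.Face // f ∈ F} → ℝ)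
    (v : {v : V // v ≠ b ∧ v ≠ c}) :
    (T.incidenceMatrix b c F).mulVec x v =
      ∑ f : {f : T.Face // f ∈ F} with T.Incident v.1 f.1, x f := by
  simp [incidenceMatrix, Matrix.mulVec, dotProduct, Finset.sum_filter]

theorem isSizeSolution_iff_mulVec_eq [DecidableEq V] {a b c : V} {x : {f : T.Face // f ∈ F} → ℝ} :
    T.IsSizeSolution a b c F x ↔
      (T.incidenceMatrix b c F).mulVec x = fun v => if v.1 = a then 1 else 0 := by
  simp only [IsSizeSolution, funext_iff, incidenceMatrix_mulVec, Subtype.forall]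
  refine forall_congr' fun v => ?_
  rw [← and_imp]
  congr!

theorem IsCyclicColoring.incidenceMatrix_mulVec_eq_vertexSum [Fintype G.Dart] [DecidableEq V]
    [DecidableEq T.Face] {col : V → ZMod 3} (hcol : T.IsCyclicColoring F col)
    (hF : T.IsFaceColorClass F) (h3 : ∀ f, T.faceSize f = 3) {b c : V} (X : T.Face → ℝ)
    (v : {v : V // v ≠ b ∧ v ≠ c}) :
    (T.incidenceMatrix b c F).mulVec (fun f => X f.1) v = T.vertexSum F X v := by
  classical
  rw [incidenceMatrix_mulVec, hcol.vertexSum_eq_sum_incident hF h3, Finset.sum_filter,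
    Finset.sum_filter]
  exact Finset.sum_coe_sort F fun f => if T.Incident v.1 f then X f else 0

theorem IsCyclicColoring.incidenceMatrix_mulVec_injective [Finite V] {col : V → ZMod 3}
    (hcol : T.IsCyclicColoring F col) (hF : T.IsFaceColorClass F) (hT : T.IsTriangulation) {b c : V}
    (hbc : col b ≠ col c) : Function.Injective (T.incidenceMatrix b c F).mulVec := by
  classical
  have := Fintype.ofFinite V
  refine (injective_iff_map_eq_zero (T.incidenceMatrix b c F).mulVecLin).mpr fun x hx => ?_
  obtain ⟨X, rfl⟩ := Subtype.val_injective.surjective_comp_right x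
  have hX : ∀ v, v ≠ b → v ≠ c → T.vertexSum F X v = 0 := fun v hvb hvc =>
    (hcol.incidenceMatrix_mulVec_eq_vertexSum hF hT.2 X ⟨v, hvb, hvc⟩).symm.trans
      (congrFun hx ⟨v, hvb, hvc⟩)
  exact funext fun f =>
    hcol.eq_zero_of_vertexSum_eq_zero hF hT (hcol.vertexSum_eq_zero hF hT.2 hbc hX) f.2

end IncidenceMatrix

end RotationSystem

section MulVec

variable {K m n : Type*} [Field K] [Fintype n] {M : Matrix m n K}

theorem det_submatrix_ne_zero_of_mulVec_injective (hM : Function.Injective M.mulVec) {ι : Type*}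
    [Fintype ι] [DecidableEq ι] (e₁ : ι ≃ m) (e₂ : ι ≃ n) : (M.submatrix e₁ e₂).det ≠ 0 := by
  have hsub : Function.Injective (M.submatrix e₁ e₂).mulVec := fun x y hxy => by
    simp only [Matrix.submatrix_mulVec_equiv] at hxy
    exact e₂.symm.surjective.injective_comp_right (hM (e₁.surjective.injective_comp_right hxy))
  exact ((Matrix.isUnit_iff_isUnit_det _).mp (Matrix.mulVec_injective_iff_isUnit.mp hsub)).ne_zero

theorem mulVec_bijective_of_injective [Fintype m] (hM : Function.Injective M.mulVec)
    (hmn : Fintype.card n = Fintype.card m) : Function.Bijective M.mulVec :=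
  ⟨hM, (LinearMap.injective_iff_surjective_of_finrank_eq_finrank (f := M.mulVecLin)
    (by simpa only [Module.finrank_fintype_fun_eq_card] using hmn)).mp hM⟩

end MulVec

theorem card_subtype_ne_and_ne {V : Type*} [Fintype V] [DecidableEq V] {b c : V} (hbc : b ≠ c) :
    Fintype.card {v : V // v ≠ b ∧ v ≠ c} = Fintype.card V - 2 := by
  have hcompl : ({v | v ≠ b ∧ v ≠ c} : Finset V) = {b, c}ᶜ := by
    ext v
    simp
  rw [Fintype.card_subtype, hcompl, Finset.card_compl, Finset.card_pair hbc]

theorem lemma3_general {V : Type*} [Fintype V] [DecidableEq V] (G : SimpleGraph V)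
    (T : RotationSystem G) (hT : T.IsEulerianTriangulation)
    (o f : T.Face) (a b c : V) (hb : T.Incident b f) (hc : T.Incident c f) (hbc : b ≠ c) :
    (∃! F₁ : Finset T.Face, T.IsFirstFaceClass o F₁) ∧
    ∀ F₁ : Finset T.Face, T.IsFirstFaceClass o F₁ →
      Fintype.card {v : V // v ≠ b ∧ v ≠ c} = Fintype.card V - 2 ∧
      F₁.card = Fintype.card V - 2 ∧
      (∀ (gV : Fin (Fintype.card V - 2) ≃ {v : V // v ≠ b ∧ v ≠ c})
          (gF : Fin (Fintype.card V - 2) ≃ {f : T.Face // f ∈ F₁}),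
        ((T.incidenceMatrix b c F₁).submatrix gV gF).det ≠ 0) ∧
      ∃! x : {f : T.Face // f ∈ F₁} → ℝ, T.IsSizeSolution a b c F₁ x := by
  classical
  refine ⟨RotationSystem.existsUnique_isFirstFaceClass hT.1.1 hT.2 o, fun F₁ h => ?_⟩
  have hF := h.isFaceColorClass
  have hV := card_subtype_ne_and_ne hbc
  have hF₁ : F₁.card = Fintype.card V - 2 := Nat.eq_sub_of_add_eq (hF.card_add_two hT.1)
  obtain ⟨col, hcol⟩ := hF.exists_isCyclicColoring hT.1
  have hinj := hcol.incidenceMatrix_mulVec_injective hF hT.1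
    (hcol.ne_of_incident hF hT.1.2 hb hc hbc)
  refine ⟨hV, hF₁, det_submatrix_ne_zero_of_mulVec_injective hinj, ?_⟩
  have hbij := mulVec_bijective_of_injective hinj (by rw [Fintype.card_coe, hF₁, hV])
  simpa only [RotationSystem.isSizeSolution_iff_mulVec_eq] using hbij.existsUnique _

theorem lemma3 {V : Type*} [Fintype V] [DecidableEq V] (G : SimpleGraph V)
    (T : RotationSystem G) (hT : T.IsEulerianTriangulation)
    (o : T.Face) (a₀ b₀ c₀ : V)
    (ha : T.Incident a₀ o) (hb : T.Incident b₀ o) (hc : T.Incident c₀ o)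
    (hab : a₀ ≠ b₀) (hac : a₀ ≠ c₀) (hbc : b₀ ≠ c₀) :
    (∃! F₁ : Finset T.Face, T.IsFirstFaceClass o F₁) ∧
    ∀ F₁ : Finset T.Face, T.IsFirstFaceClass o F₁ →
      Fintype.card {v : V // v ≠ b₀ ∧ v ≠ c₀} = Fintype.card V - 2 ∧
      F₁.card = Fintype.card V - 2 ∧
      (∀ (gV : Fin (Fintype.card V - 2) ≃ {v : V // v ≠ b₀ ∧ v ≠ c₀})
          (gF : Fin (Fintype.card V - 2) ≃ {f : T.Face // f ∈ F₁}),
        ((T.incidenceMatrix b₀ c₀ F₁).submatrix gV gF).det ≠ 0) ∧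
      ∃! x : {f : T.Face // f ∈ F₁} → ℝ, T.IsSizeSolution a₀ b₀ c₀ F₁ x :=
  lemma3_general G T hT o o a₀ b₀ c₀ hb hc hbc
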